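/- Let $(R,\mathfrak m)$ be a commutative Noetherian local ring, $M$ a finitely generated $R$-module and $x\in\mathfrak m$. For a class $\mathcal S$ of $R$-modules, a sequence $x_1,\dots,x_r$ in $R$ is called a weak $M$-sequence with respect to $\mathcal S$ if $\big((x_1,\dots,x_{i-1})M:_M x_i\big)/(x_1,\dots,x_{i-1})M\in\mathcal S$ for $i=1,\dots,r$. A finitely generated $R$-module $N$ is called $\mathcal S$-Cohen–Macaulay if every system of parameters of $N$ is a weak $N$-sequence with respect to $\mathcal S$. A finitely generated $R$-module $N$ is equidimensional if $\dim R/\mathfrak p=\dim N$ for every minimal element $\mathfrak p$ of $\operatorname{Supp}_R N$. (i) Let $\mathcal S$ be a Serre class of $R$-modules (it contains $0$ and is closed under submodules, quotients and extensions). If $x$ is a weak $M$-sequence with respect to $\mathcal S$, $M$ is $\mathcal S$-Cohen–Macaulay and $M/xM$ is equidimensional, then $M/xM$ is $\mathcal S$-Cohen–Macaulay. (ii) Let $\mathcal T_0$ be the class of $R$-modules $N$ with $\operatorname{Supp}_R N\subseteq\{\mathfrak m\}$ and $\mathcal T_1$ the class of $R$-modules $N$ with $\dim N\le 1$. A finitely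 generated $R$-module is called an f-module (resp. a generalized f-module) if each of its systems of parameters is a weak sequence on it with respect to $\mathcal T_0$ (resp. $\mathcal T_1$), i.e. a filter regular (resp. generalized filter regular) sequence. If $x$ is a weak $M$-sequence with respect to $\mathcal T_0$ (resp. $\mathcal T_1$) and $M$ is an f-module (resp. a generalized f-module), then $M/xM$ is an f-module (resp. a generalized f-module). -/

import Mathlib

universe u

open CategoryTheory

namespace SerreCM

/-- The submodule `(x_j : j < i) M` of `M`. -/
def partialSubmodule {R : Type u} [CommRing R] (M : Type u) [AddCommGroup M] [Module R M]
    {r : ℕ} (x : Fin r → R) (i : Fin r) : Submodule R M :=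
  Ideal.span (x '' Set.Iio i) • (⊤ : Submodule R M)

/-- The colon submodule `N :_M a = {m ∈ M | a m ∈ N}`. -/
def colonSubmodule {R : Type u} [CommRing R] {M : Type u} [AddCommGroup M] [Module R M]
    (N : Submodule R M) (a : R) : Submodule R M :=
  N.comap (LinearMap.lsmul R M a)

/-- The sequence `x` of elements of `R` is a weak `M`-sequence with respect to the class `S` of
`R`-modules: for each `i` the module `((x_j : j < i) M :_M x_i) / (x_j : j < i) M` is in `S`. -/
def IsWeakSequence {R : Type u} [CommRing R] (S : ObjectProperty (ModuleCat.{u} R))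
    (M : Type u) [AddCommGroup M] [Module R M] {r : ℕ} (x : Fin r → R) : Prop :=
  ∀ i : Fin r, S (ModuleCat.of R
    (↥(colonSubmodule (partialSubmodule M x i) (x i)) ⧸
      (partialSubmodule M x i).submoduleOf
        (colonSubmodule (partialSubmodule M x i) (x i))))

/-- `x = (x_1, …, x_d)` is a system of parameters of the module `M` over the local ring `R`:
`d = dim M`, the `x_i` lie in the maximal ideal, and `M / (x_1, …, x_d) M` has finite length. -/
def IsSystemOfParameters {R : Type u} [CommRing R] [IsLocalRing R]
    (M : Type u) [AddCommGroup M] [Module R M] {d : ℕ} (x : Fin d → R) : Prop :=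
  Module.supportDim R M = (d : WithBot ℕ∞) ∧
    (∀ i, x i ∈ IsLocalRing.maximalIdeal R) ∧
    IsFiniteLength R (M ⧸ (Ideal.span (Set.range x) • (⊤ : Submodule R M)))

/-- `M` is `S`-Cohen–Macaulay: it is finitely generated and every system of parameters of `M` is
a weak `M`-sequence with respect to `S`. -/
def IsSerreCohenMacaulay {R : Type u} [CommRing R] [IsLocalRing R]
    (S : ObjectProperty (ModuleCat.{u} R)) (M : Type u) [AddCommGroup M] [Module R M] : Prop :=
  Module.Finite R M ∧
    ∀ (d : ℕ) (x : Fin d → R), IsSystemOfParameters M x → IsWeakSequence S M x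

/-- `M` is equidimensional: `dim R/p = dim M` for every minimal element `p` of `Supp M`. -/
def IsEquidimensional (R : Type u) [CommRing R] (M : Type u) [AddCommGroup M] [Module R M] :
    Prop :=
  ∀ p : PrimeSpectrum R, Minimal (· ∈ Module.support R M) p →
    ringKrullDim (R ⧸ p.asIdeal) = Module.supportDim R M

/-- The class of modules `N` with `Supp N ⊆ {𝔪}`. -/
def supportedAtMaximal (R : Type u) [CommRing R] [IsLocalRing R] :
    ObjectProperty (ModuleCat.{u} R) :=
  fun N => Module.support R N ⊆ {IsLocalRing.closedPoint R}

/-- The class of modules `N` with `dim N ≤ 1`. -/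
def dimLeOne (R : Type u) [CommRing R] : ObjectProperty (ModuleCat.{u} R) :=
  fun N => Module.supportDim R N ≤ 1

/-- `x` is a filter regular sequence on `M`. -/
def IsFilterRegular {R : Type u} [CommRing R] [IsLocalRing R]
    (M : Type u) [AddCommGroup M] [Module R M] {r : ℕ} (x : Fin r → R) : Prop :=
  IsWeakSequence (supportedAtMaximal R) M x

/-- `x` is a generalized filter regular sequence on `M`. -/
def IsGeneralizedFilterRegular {R : Type u} [CommRing R]
    (M : Type u) [AddCommGroup M] [Module R M] {r : ℕ} (x : Fin r → R) : Prop :=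
  IsWeakSequence (dimLeOne R) M x

/-- f-modules: finitely generated modules all of whose systems of parameters are filter regular
sequences. -/
def IsFModule (R : Type u) [CommRing R] [IsLocalRing R]
    (M : Type u) [AddCommGroup M] [Module R M] : Prop :=
  Module.Finite R M ∧
    ∀ (d : ℕ) (x : Fin d → R), IsSystemOfParameters M x → IsFilterRegular M x

/-- Generalized f-modules: finitely generated modules all of whose systems of parameters are
generalized filter regular sequences. -/
def IsGeneralizedFModule (R : Type u) [CommRing R] [IsLocalRing R]
    (M : Type u) [AddCommGroup M] [Module R M] : Prop :=
  Module.Finite R M ∧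
    ∀ (d : ℕ) (x : Fin d → R), IsSystemOfParameters M x → IsGeneralizedFilterRegular M x

end SerreCM

/-! Since `x` lies in the maximal ideal, `dim M/xM` is `dim M` or `dim M - 1`. If it drops,
prepending `x` to a system of parameters of `M/xM` gives one of `M`, and the weak sequence condition
descends modulo `x`. If it stays equal to `d`, a prime `p` of `Supp M/xM` with `dim R/p = d` is
minimal in `Supp M`, hence associated to `M`, and contains `x`; so `R/p` embeds in `0 :_M x` and
lies in the class (`prop_quotient_of_ringKrullDim_eq`). Under equidimensionality this covers all
minimal primes, so `M/xM` itself lies in the Serre class and every sequence on it is weak. For the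
two concrete classes a single such `p` suffices, because membership of `R/p` bounds `d`. -/

namespace SerreCM

open Module
open scoped Pointwise

/-! ### Colon quotients and systems of parameters modulo `x`. -/

section Submodules

variable {R : Type u} [CommRing R] {M : Type u} [AddCommGroup M] [Module R M]
  {M' : Type u} [AddCommGroup M'] [Module R M']

lemma comap_ideal_smul_top {f : M →ₗ[R] M'} (hf : Function.Surjective f) {J : Ideal R}
    (hJ : LinearMap.ker f = J • (⊤ : Submodule R M)) (I : Ideal R) :
    (I • (⊤ : Submodule R M')).comap f = (J ⊔ I) • (⊤ : Submodule R M) := by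
  rw [← LinearMap.range_eq_top.mpr hf, LinearMap.range_eq_map, ← Submodule.map_smul'',
    Submodule.comap_map_eq, hJ, Submodule.sup_smul, sup_comm]

lemma ker_mkQ_quotSMulTop (x : R) :
    LinearMap.ker (Submodule.mkQ (x • (⊤ : Submodule R M))) =
      Ideal.span {x} • (⊤ : Submodule R M) := by
  rw [Submodule.ker_mkQ, Submodule.ideal_span_singleton_smul]

lemma comap_partialSubmodule_quotSMulTop (x : R) {d : ℕ} (y : Fin d → R) (i : Fin d) :
    (partialSubmodule (QuotSMulTop x M) y i).comap (Submodule.mkQ (x • (⊤ : Submodule R M))) =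
      partialSubmodule M (Fin.cons x y : Fin (d + 1) → R) i.succ := by
  have hset : (Fin.cons x y : Fin (d + 1) → R) '' Set.Iio i.succ = {x} ∪ y '' Set.Iio i := by
    ext r
    simp only [Set.mem_image, Set.mem_Iio, Fin.exists_fin_succ, Fin.cons_zero, Fin.cons_succ,
      Fin.succ_lt_succ_iff, Fin.succ_pos, true_and, Set.mem_union, Set.mem_singleton_iff]
    exact or_congr_left eq_comm
  unfold partialSubmodule
  rw [hset, Ideal.span_union]
  exact comap_ideal_smul_top (Submodule.mkQ_surjective _) (ker_mkQ_quotSMulTop x) _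

lemma colonSubmodule_comap (f : M →ₗ[R] M') (N : Submodule R M') (a : R) :
    colonSubmodule (N.comap f) a = (colonSubmodule N a).comap f := by
  ext m
  simp [colonSubmodule]

lemma isWeakSequence_of_prop {S : ObjectProperty (ModuleCat.{u} R)}
    [S.IsClosedUnderSubobjects] [S.IsClosedUnderQuotients] (hM : S (ModuleCat.of R M))
    {d : ℕ} (y : Fin d → R) : IsWeakSequence S M y := by
  intro i
  have : S (ModuleCat.of R ↥(colonSubmodule (partialSubmodule M y i) (y i))) := by
    have : Mono (ModuleCat.ofHom (colonSubmodule (partialSubmodule M y i) (y i)).subtype) :=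
      (ModuleCat.mono_iff_injective _).mpr (Submodule.subtype_injective _)
    exact S.prop_of_mono (ModuleCat.ofHom (Submodule.subtype _)) hM
  have : Epi (ModuleCat.ofHom ((partialSubmodule M y i).submoduleOf
      (colonSubmodule (partialSubmodule M y i) (y i))).mkQ) :=
    (ModuleCat.epi_iff_surjective _).mpr (Submodule.mkQ_surjective _)
  exact S.prop_of_epi (ModuleCat.ofHom (Submodule.mkQ _)) ‹_›

/-- Colons commute with preimages, so `f` induces a surjection between the two colon quotients. -/
lemma prop_colon_quotient_of_comap {S : ObjectProperty (ModuleCat.{u} R)}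
    [S.IsClosedUnderQuotients] {f : M →ₗ[R] M'} (hf : Function.Surjective f)
    {N : Submodule R M} {N' : Submodule R M'} (hN : N'.comap f = N) (a : R)
    (h : S (ModuleCat.of R (↥(colonSubmodule N a) ⧸ N.submoduleOf (colonSubmodule N a)))) :
    S (ModuleCat.of R (↥(colonSubmodule N' a) ⧸ N'.submoduleOf (colonSubmodule N' a))) := by
  subst hN
  have hle : ∀ m ∈ colonSubmodule (N'.comap f) a, f m ∈ colonSubmodule N' a := by
    intro m hm
    rwa [colonSubmodule_comap] at hm
  let g := f.restrict hle
  have hg : Function.Surjective g := by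
    rintro ⟨m', hm'⟩
    obtain ⟨m, rfl⟩ := hf m'
    exact ⟨⟨m, by rwa [colonSubmodule_comap]⟩, rfl⟩
  let φ := Submodule.mapQ ((N'.comap f).submoduleOf (colonSubmodule (N'.comap f) a))
    (N'.submoduleOf (colonSubmodule N' a)) g (fun m hm => hm)
  have hφ : Function.Surjective φ := by
    intro z
    obtain ⟨z, rfl⟩ := Submodule.mkQ_surjective _ z
    obtain ⟨w, rfl⟩ := hg z
    exact ⟨Submodule.mkQ _ w, rfl⟩
  have : Epi (ModuleCat.ofHom φ) := (ModuleCat.epi_iff_surjective _).mpr hφ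
  exact S.prop_of_epi (ModuleCat.ofHom φ) h

lemma isWeakSequence_quotSMulTop {S : ObjectProperty (ModuleCat.{u} R)}
    [S.IsClosedUnderQuotients] {x : R} {d : ℕ} {y : Fin d → R}
    (h : IsWeakSequence S M (Fin.cons x y : Fin (d + 1) → R)) :
    IsWeakSequence S (QuotSMulTop x M) y := fun i =>
  prop_colon_quotient_of_comap (Submodule.mkQ_surjective _)
    (comap_partialSubmodule_quotSMulTop x y i) (y i) (h i.succ)

lemma isSystemOfParameters_cons [IsLocalRing R] {x : R}
    (hx : x ∈ IsLocalRing.maximalIdeal R) {d : ℕ} {y : Fin d → R}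
    (hdim : supportDim R M = ((d + 1 : ℕ) : WithBot ℕ∞))
    (hy : IsSystemOfParameters (QuotSMulTop x M) y) :
    IsSystemOfParameters M (Fin.cons x y : Fin (d + 1) → R) := by
  refine ⟨hdim, Fin.cases hx hy.2.1, ?_⟩
  let q := Submodule.mkQ (x • (⊤ : Submodule R M))
  let N := Ideal.span (Set.range y) • (⊤ : Submodule R (QuotSMulTop x M))
  have hker : LinearMap.ker (N.mkQ ∘ₗ q) =
      Ideal.span (Set.range (Fin.cons x y : Fin (d + 1) → R)) • (⊤ : Submodule R M) := by
    rw [LinearMap.ker_comp, Submodule.ker_mkQ, Fin.range_cons, Ideal.span_insert]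
    exact comap_ideal_smul_top (Submodule.mkQ_surjective _) (ker_mkQ_quotSMulTop x) _
  have hsurj : Function.Surjective (N.mkQ ∘ₗ q) :=
    (Submodule.mkQ_surjective _).comp (Submodule.mkQ_surjective _)
  exact ((Submodule.quotEquivOfEq _ _ hker).symm.trans
    ((N.mkQ ∘ₗ q).quotKerEquivOfSurjective hsurj)).symm.isFiniteLength hy.2.2

/-- The only condition on `![x]` concerns `0 :_M x`, which contains the image of any map from a
module killed by `x`. -/
lemma prop_of_injective_of_isWeakSequence_singleton {S : ObjectProperty (ModuleCat.{u} R)}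
    [S.IsClosedUnderSubobjects] {x : R} (h : IsWeakSequence S M ![x])
    (f : M' →ₗ[R] M) (hf : Function.Injective f) (hx : ∀ m, x • m = (0 : M')) :
    S (ModuleCat.of R M') := by
  have hbot : partialSubmodule M ![x] 0 = ⊥ := by
    simp [partialSubmodule]
  have hmem : ∀ m, f m ∈ colonSubmodule (partialSubmodule M ![x] 0) (![x] 0) := by
    intro m
    simp [colonSubmodule, ← map_smul, hx]
  let g := Submodule.mkQ ((partialSubmodule M ![x] 0).submoduleOf
    (colonSubmodule (partialSubmodule M ![x] 0) (![x] 0))) ∘ₗ f.codRestrict _ hmem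
  have hg : Function.Injective g := by
    rw [← LinearMap.ker_eq_bot, LinearMap.ker_eq_bot']
    intro m hm
    have hm' : f m ∈ partialSubmodule M ![x] 0 := by
      rw [LinearMap.comp_apply, Submodule.mkQ_apply, Submodule.Quotient.mk_eq_zero] at hm
      exact hm
    rw [hbot, Submodule.mem_bot] at hm'
    exact (map_eq_zero_iff f hf).mp hm'
  have : Mono (ModuleCat.ofHom g) := (ModuleCat.mono_iff_injective _).mpr hg
  exact S.prop_of_mono (ModuleCat.ofHom g) (h 0)

end Submodules

/-! ### Primes of maximal dimension and membership in the class. -/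

section Dimension

variable {R : Type u} [CommRing R] {M : Type u} [AddCommGroup M] [Module R M]

lemma mem_support_quotient_prime {p q : PrimeSpectrum R} :
    q ∈ support R (R ⧸ p.asIdeal) ↔ p ≤ q := by
  rw [support_eq_zeroLocus, Ideal.annihilator_quotient, PrimeSpectrum.mem_zeroLocus]
  exact Iff.rfl

lemma support_quotient_prime_subset {p : PrimeSpectrum R} (hp : p ∈ support R M) :
    support R (R ⧸ p.asIdeal) ⊆ support R M := fun _ hq =>
  mem_support_mono (mem_support_quotient_prime.mp hq) hp

lemma ringKrullDim_quotient_prime_le {p : PrimeSpectrum R} (hp : p ∈ support R M) :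
    ringKrullDim (R ⧸ p.asIdeal) ≤ supportDim R M := by
  rw [← supportDim_quotient_eq_ringKrullDim]
  exact Order.krullDim_le_of_strictMono (fun a => ⟨a.1, support_quotient_prime_subset hp a.2⟩)
    fun _ _ h => h

lemma exists_ringKrullDim_quotient_eq_supportDim {d : ℕ} (hd : supportDim R M = d) :
    ∃ p ∈ support R M, ringKrullDim (R ⧸ p.asIdeal) = d := by
  obtain ⟨l, hl⟩ := Order.le_krullDim_iff.mp hd.ge
  refine ⟨l.head.1, l.head.2, le_antisymm (hd ▸ ringKrullDim_quotient_prime_le l.head.2) ?_⟩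
  rw [← supportDim_quotient_eq_ringKrullDim]
  refine Order.le_krullDim_iff.mpr
    ⟨⟨l.length, fun i => ⟨(l i).1, mem_support_quotient_prime.mpr ?_⟩, l.step⟩, hl⟩
  exact LTSeries.head_le l i

lemma minimal_support_of_ringKrullDim_quotient_eq {d : ℕ} (hd : supportDim R M = d)
    {p : PrimeSpectrum R} (hp : p ∈ support R M) (hpd : ringKrullDim (R ⧸ p.asIdeal) = d) :
    Minimal (· ∈ support R M) p := by
  rw [minimal_iff_forall_lt]
  refine ⟨hp, fun q hqp hq => ?_⟩
  rw [← supportDim_quotient_eq_ringKrullDim] at hpd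
  obtain ⟨l, hl⟩ := Order.le_krullDim_iff.mp hpd.ge
  obtain ⟨l', hl', hqh⟩ : ∃ l' : LTSeries (support R M), l'.length = d ∧ q < l'.head.1 :=
    ⟨l.map (fun a => ⟨a.1, support_quotient_prime_subset hp a.2⟩) fun _ _ h => h, hl,
      lt_of_lt_of_le hqp (mem_support_quotient_prime.mp l.head.2)⟩
  -- Prepending `q` to a chain of length `d` above `p` gives a chain in `Supp M` longer than its
  -- dimension.
  have hle : ((d + 1 : ℕ) : WithBot ℕ∞) ≤ d := by
    rw [← hd]
    exact Order.le_krullDim_iff.mpr ⟨l'.cons ⟨q, hq⟩ hqh, by simp [hl']⟩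
  have : d + 1 ≤ d := by exact_mod_cast hle
  omega

variable [IsNoetherianRing R] [Module.Finite R M]

lemma exists_injective_quotient_of_minimal_support {p : PrimeSpectrum R}
    (hp : Minimal (· ∈ support R M) p) :
    ∃ f : (R ⧸ p.asIdeal) →ₗ[R] M, Function.Injective f := by
  have hmin : p.asIdeal ∈ (annihilator R M).minimalPrimes := by
    refine ⟨⟨p.2, annihilator_le_of_mem_support hp.1⟩, fun J hJ hJp => ?_⟩
    refine hp.2 (y := ⟨J, hJ.1⟩) ?_ hJp
    rw [support_eq_zeroLocus]
    exact hJ.2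
  have hass := Module.associatedPrimes.minimalPrimes_annihilator_subset_associatedPrimes R M hmin
  exact ((isAssociatedPrime_iff_exists_injective_linearMap (R := R) (M := M) _).mp hass).2

lemma prop_quotient_of_ringKrullDim_eq {S : ObjectProperty (ModuleCat.{u} R)}
    [S.IsClosedUnderSubobjects] {x : R} (h : IsWeakSequence S M ![x]) {d : ℕ}
    (hd : supportDim R M = d) {p : PrimeSpectrum R} (hp : p ∈ support R (QuotSMulTop x M))
    (hpd : ringKrullDim (R ⧸ p.asIdeal) = d) : S (ModuleCat.of R (R ⧸ p.asIdeal)) := by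
  rw [support_quotSMulTop] at hp
  obtain ⟨f, hf⟩ := exists_injective_quotient_of_minimal_support
    (minimal_support_of_ringKrullDim_quotient_eq hd hp.1 hpd)
  have hxp : x ∈ p.asIdeal := by simpa using hp.2
  refine prop_of_injective_of_isWeakSequence_singleton h f hf fun m => ?_
  obtain ⟨r, rfl⟩ := Ideal.Quotient.mk_surjective m
  exact Ideal.Quotient.eq_zero_iff_mem.mpr (p.asIdeal.mul_mem_right r hxp)

/-- Dévissage along a prime filtration, whose factors `R/p` all have `p` in the support. -/
lemma prop_of_forall_support (S : ObjectProperty (ModuleCat.{u} R)) [S.IsSerreClass]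
    (h : ∀ p ∈ support R M, S (ModuleCat.of R (R ⧸ p.asIdeal))) : S (ModuleCat.of R M) := by
  induction ‹Module.Finite R M› using
    IsNoetherianRing.induction_on_isQuotientEquivQuotientPrime R with
  | subsingleton N => exact S.prop_of_isZero (ModuleCat.isZero_of_subsingleton _)
  | quotient N p e =>
    refine S.prop_of_iso e.toModuleIso.symm (h p ?_)
    rw [e.support_eq]
    exact mem_support_quotient_prime.mpr le_rfl
  | exact N₁ N₂ N₃ f g hf hg hfg h₁ h₃ =>
    refine S.prop_X₂_of_shortExact
      (S := ShortComplex.mk (ModuleCat.ofHom f) (ModuleCat.ofHom g) ?_) ?_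
      (h₁ fun p hp => h p (support_subset_of_injective f hf hp))
      (h₃ fun p hp => h p (support_subset_of_surjective g hg hp))
    · ext m
      exact hfg.apply_apply_eq_zero m
    · exact ModuleCat.shortComplex_shortExact _ hfg hf hg

/-- Each `R/q` with `q` in the support is a quotient of `R/p` for some minimal `p ≤ q`. -/
lemma prop_of_forall_minimal_support (S : ObjectProperty (ModuleCat.{u} R)) [S.IsSerreClass]
    (h : ∀ p, Minimal (· ∈ support R M) p → S (ModuleCat.of R (R ⧸ p.asIdeal))) :
    S (ModuleCat.of R M) := by
  refine prop_of_forall_support S fun q hq => ?_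
  rw [support_eq_zeroLocus] at hq
  obtain ⟨p, hp, hpq⟩ := Ideal.exists_minimalPrimes_le (J := q.asIdeal) hq
  let P : PrimeSpectrum R := ⟨p, hp.1.1⟩
  have hmin : Minimal (· ∈ support R M) P := by
    rw [minimal_iff_forall_lt]
    refine ⟨?_, fun J hJp hJ => ?_⟩
    · rw [support_eq_zeroLocus]
      exact hp.1.2
    · rw [support_eq_zeroLocus] at hJ
      exact hJp.not_ge (hp.2 (y := J.asIdeal) ⟨J.2, hJ⟩ hJp.le)
  let f : (R ⧸ P.asIdeal) →ₗ[R] (R ⧸ q.asIdeal) := Submodule.factor hpq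
  have hf : Function.Surjective f := Submodule.factor_surjective hpq
  have : Epi (ModuleCat.ofHom f) := (ModuleCat.epi_iff_surjective _).mpr hf
  exact S.prop_of_epi (ModuleCat.ofHom f) (h P hmin)

lemma isWeakSequence_quotSMulTop_of_dichotomy [IsLocalRing R]
    {S : ObjectProperty (ModuleCat.{u} R)}
    [S.IsClosedUnderSubobjects] [S.IsClosedUnderQuotients] {x : R}
    (hx : x ∈ IsLocalRing.maximalIdeal R)
    (hM : ∀ (d : ℕ) (z : Fin d → R), IsSystemOfParameters M z → IsWeakSequence S M z)
    (hS : ∀ d : ℕ, supportDim R M = d → supportDim R (QuotSMulTop x M) = d →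
      S (ModuleCat.of R (QuotSMulTop x M)))
    {d : ℕ} {y : Fin d → R} (hy : IsSystemOfParameters (QuotSMulTop x M) y) :
    IsWeakSequence S (QuotSMulTop x M) y := by
  have hle : supportDim R (QuotSMulTop x M) ≤ supportDim R M :=
    supportDim_le_of_surjective (Submodule.mkQ _) (Submodule.mkQ_surjective _)
  have hge := supportDim_le_supportDim_quotSMulTop_succ (M := M) hx
  rw [hy.1] at hle hge
  have hcases : supportDim R M = d ∨ supportDim R M = ((d + 1 : ℕ) : WithBot ℕ∞) := by
    generalize supportDim R M = e at hle hge
    induction e using WithBot.recBotCoe with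
    | bot => simp at hle
    | coe e =>
      have hle' : (d : ℕ∞) ≤ e := by exact_mod_cast hle
      have hge' : e ≤ ((d + 1 : ℕ) : ℕ∞) := by exact_mod_cast hge
      lift e to ℕ using ne_top_of_le_ne_top (ENat.natCast_ne_top _) hge'
      norm_cast at hle' hge' ⊢
      omega
  rcases hcases with h | h
  · exact isWeakSequence_of_prop (hS d h hy.1) y
  · exact isWeakSequence_quotSMulTop (hM _ _ (isSystemOfParameters_cons hx h hy))

end Dimension

/-! ### Closure properties of the two concrete classes. -/

section Classes

variable {R : Type u} [CommRing R]

instance [IsLocalRing R] : (supportedAtMaximal R).IsClosedUnderSubobjects where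
  prop_of_mono f _ h := (support_subset_of_injective f.hom
    ((ModuleCat.mono_iff_injective f).mp inferInstance)).trans h

instance [IsLocalRing R] : (supportedAtMaximal R).IsClosedUnderQuotients where
  prop_of_epi f _ h := (support_subset_of_surjective f.hom
    ((ModuleCat.epi_iff_surjective f).mp inferInstance)).trans h

instance : (dimLeOne R).IsClosedUnderSubobjects where
  prop_of_mono f _ h := (supportDim_le_of_injective f.hom
    ((ModuleCat.mono_iff_injective f).mp inferInstance)).trans h

instance : (dimLeOne R).IsClosedUnderQuotients where
  prop_of_epi f _ h := (supportDim_le_of_surjective f.hom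
    ((ModuleCat.epi_iff_surjective f).mp inferInstance)).trans h

lemma supportDim_le_zero_of_support_subset [IsLocalRing R] {N : Type u} [AddCommGroup N]
    [Module R N] (h : support R N ⊆ {IsLocalRing.closedPoint R}) : supportDim R N ≤ 0 := by
  have : Subsingleton (support R N) :=
    (Set.subsingleton_singleton.anti h).coe_sort
  exact Order.krullDim_nonpos_of_subsingleton

end Classes

end SerreCM

/-- `QuotSMulTop x M` is `M / x M`. -/
theorem corollary3p7 {R : Type u} [CommRing R] [IsNoetherianRing R] [IsLocalRing R]
    {M : Type u} [AddCommGroup M] [Module R M] [Module.Finite R M]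
    (x : R) (hx : x ∈ IsLocalRing.maximalIdeal R) :
    (∀ (S : ObjectProperty (ModuleCat.{u} R)) [S.IsSerreClass],
      SerreCM.IsWeakSequence S M ![x] →
      SerreCM.IsEquidimensional R (QuotSMulTop x M) →
      SerreCM.IsSerreCohenMacaulay S M →
      SerreCM.IsSerreCohenMacaulay S (QuotSMulTop x M)) ∧
    (SerreCM.IsFilterRegular M ![x] → SerreCM.IsFModule R M →
      SerreCM.IsFModule R (QuotSMulTop x M)) ∧
    (SerreCM.IsGeneralizedFilterRegular M ![x] → SerreCM.IsGeneralizedFModule R M →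
      SerreCM.IsGeneralizedFModule R (QuotSMulTop x M)) := by
  have mem_support {d : ℕ} (hd : Module.supportDim R (QuotSMulTop x M) = d) :=
    SerreCM.exists_ringKrullDim_quotient_eq_supportDim hd
  refine ⟨fun S _ hw heq hM => ⟨inferInstance, fun _ _ hy => ?_⟩,
    fun hw hM => ⟨inferInstance, fun _ _ hy => ?_⟩,
    fun hw hM => ⟨inferInstance, fun _ _ hy => ?_⟩⟩ <;>
  refine SerreCM.isWeakSequence_quotSMulTop_of_dichotomy hx hM.2 (fun d hd hd' => ?_) hy
  · exact SerreCM.prop_of_forall_minimal_support S fun p hp =>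
      SerreCM.prop_quotient_of_ringKrullDim_eq hw hd hp.1 ((heq p hp).trans hd')
  · obtain ⟨p, hp, hpd⟩ := mem_support hd'
    have h := SerreCM.supportDim_le_zero_of_support_subset
      (SerreCM.prop_quotient_of_ringKrullDim_eq hw hd hp hpd)
    rw [Module.supportDim_quotient_eq_ringKrullDim, hpd] at h
    obtain rfl : d = 0 := by
      have : d ≤ 0 := by exact_mod_cast h
      omega
    -- Over a local ring, a module of dimension zero is supported only at the closed point.
    refine (support_of_supportDim_eq_zero R _ hd').le.trans ?_
    rw [PrimeSpectrum.zeroLocus_eq_singleton]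
    exact subset_rfl
  · obtain ⟨p, hp, hpd⟩ := mem_support hd'
    have h : Module.supportDim R (R ⧸ p.asIdeal) ≤ 1 :=
      SerreCM.prop_quotient_of_ringKrullDim_eq hw hd hp hpd
    rw [Module.supportDim_quotient_eq_ringKrullDim, hpd, ← hd'] at h
    exact h
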